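/- Let $\Delta$ be the open unit disk, let $\mu\in\Omega:=\{\lambda\in\mathbb C:\ |\lambda-1|\le 1,\ \lambda\ne0\}$ and $\beta\in[0,1)$, and let $f\in G(\mu,\beta)$; that is, $f:\Delta\to\mathbb C$ is holomorphic, injective and zero-free, $f(0)=1$, and $$\operatorname{Re}\left(\frac2\mu\cdot\frac{zf'(z)}{f(z)}+\frac{1+z}{1-z}\right)>\beta\qquad(z\in\Delta).$$ Let $\log f$ be the holomorphic branch on $\Delta$ with $\log f(0)=0$. For $c\in\mathbb C$ put $f^{c}=\exp(c\log f)$ and $\arg f^{c}=\operatorname{Im}(c\log f)$. Then the limits $$\nu=\lim_{r\to1^-}\frac{f'(r)(r-1)}{f(r)}\in\Omega,\qquad a=\lim_{r\to1^-}\arg f^{1/\nu}(r)\in\mathbb R$$ exist, the number $\nu/\mu$ is real, and $$\beta\le\frac\nu\mu\le1,\qquad |a|<\frac\pi2\,\frac\mu\nu\,(1-\beta).$$ Moreover $|a|<\frac\pi2\min\left(1,\frac{1-\beta}{\beta}\right)$, where the minimum is read as $1$ if $\beta=0$. Finally, $f$ is subordinate to $$h_{\nu,a}(z)=\left(\frac{1-z}{1+e^{-2ia}z}\right)^{\nu}$$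 (principal power, which is holomorphic on $\Delta$ because $|a|<\frac\pi2$); that is, there is a holomorphic function $\omega$ on $\Delta$ with $|\omega(z)|\le|z|$ for all $z\in\Delta$ such that $f=h_{\nu,a}\circ\omega$ on $\Delta$. -/

import Mathlib

open Filter Topology

noncomputable section

namespace SpiralBoundary

/-- The open unit disk. -/
def disk : Set ℂ := Metric.ball 0 1

/-- The parameter set `Ω = {λ : |λ - 1| ≤ 1, λ ≠ 0}`. -/
def Omega : Set ℂ := {l | ‖l - 1‖ ≤ 1 ∧ l ≠ 0}

/-- `f` belongs to the class `G(μ, β)`: `f` is univalent (holomorphic and injective) on the unit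
disk, `f(0) = 1`, and `Re ((2/μ) z f'(z)/f(z) + (1+z)/(1-z)) > β` on the disk. The field
`ne_zero` only says that the quotient in the inequality is defined. -/
structure MemG (μ : ℂ) (β : ℝ) (f : ℂ → ℂ) : Prop where
  holo : DifferentiableOn ℂ f disk
  inj : Set.InjOn f disk
  map_zero : f 0 = 1
  ne_zero : ∀ z ∈ disk, f z ≠ 0
  ineq : ∀ z ∈ disk, β < (2 / μ * (z * deriv f z / f z) + (1 + z) / (1 - z)).re

/-- Subordination `s₁ ≺ s₂` of holomorphic functions on the unit disk. -/
def Subordinate (s₁ s₂ : ℂ → ℂ) : Prop :=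
  DifferentiableOn ℂ s₁ disk ∧ DifferentiableOn ℂ s₂ disk ∧
    ∃ ω : ℂ → ℂ, DifferentiableOn ℂ ω disk ∧ (∀ z ∈ disk, ‖ω z‖ ≤ ‖z‖) ∧
      ∀ z ∈ disk, s₁ z = s₂ (ω z)

/-- `h_{ν,a}(z) = ((1 - z) / (1 + e^{-2ia} z))^ν`. For `|a| < π/2` and `z` in the unit disk the
base lies in the half-plane `Re (e^{-ia} w) > 0`, which misses the negative real axis, so that the
principal power is the holomorphic branch with value `1` at `z = 0`. -/
def h (ν : ℂ) (a : ℝ) (z : ℂ) : ℂ :=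
  ((1 - z) / (1 + Complex.exp (-2 * Complex.I * (a : ℂ)) * z)) ^ ν

/-- `L` is the holomorphic branch of `log f` on the unit disk with `L(0) = 0` (it is unique on
the disk). The power `f^c` is then `exp (c L)`, and `arg f^c` is `Im (c L)`, the continuous
argument that vanishes at `0`. -/
def IsLogBranch (f L : ℂ → ℂ) : Prop :=
  DifferentiableOn ℂ L disk ∧ L 0 = 0 ∧ ∀ z ∈ disk, Complex.exp (L z) = f z

/-- `lim_{r → 1⁻} f'(r) (r - 1) / f(r) = ν`. -/
def HasBoundaryExponent (f : ℂ → ℂ) (ν : ℂ) : Prop :=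
  Tendsto (fun r : ℝ => deriv f (r : ℂ) * ((r : ℂ) - 1) / f (r : ℂ)) (𝓝[<] 1) (𝓝 ν)

/-- `lim_{r → 1⁻} arg f^{1/ν}(r) = a`. -/
def HasBoundaryArg (f : ℂ → ℂ) (ν : ℂ) (a : ℝ) : Prop :=
  ∃ L : ℂ → ℂ, IsLogBranch f L ∧
    Tendsto (fun r : ℝ => (1 / ν * L (r : ℂ)).im) (𝓝[<] 1) (𝓝 a)

end SpiralBoundary

end

/-! The Herglotz theorem supplies a probability measure `σ` on the circle such that the quantity in
`ineq` is β + (1-β)∫(1+zy)/(1-zy) dσ(y). Integrating, log f = μ(log(1-z) - (1-β)∫log(1-zy) dσ(y))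
(`MemG.isLogBranch`).

Both radial limits at 1 can be read off by dominated convergence. With s = σ{1} and R = 1-(1-β)s,
they are ν = μR and a = -((1-β)/R)∫arg(1-y) dσ(y). Injectivity enters only to exclude R = 0, which
would force f to be constant.

Put u_z(y) = arg(1-z) - arg(1-zy) + arg(1-y). Then Im((log f)/ν) - a = (β arg(1-z) + (1-β)∫u_z
dσ)/R. Here |u_z| < π/2, because (1-z)(1-y)/(1-zy) lies in the right half-plane for y ≠ 1
(`abs_arg_add_arg_sub_arg_lt`), and u_z(1) = 0. The atom at 1 therefore contributes nothing, and the
numerator is less than (π/2)(β + (1-β)(1-s)) = (π/2)R. So (log f)/ν stays in the strip |Im - a| <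
π/2, which the Schwarz lemma turns into subordination (`subordinate_h_of_abs_im_sub_lt`). -/

open MeasureTheory

/-! ### Herglotz representation by compactness of probability measures -/

/-- A harmonic density on a smaller circle gives a probability measure on the unit circle which
represents the dilated function through the Poisson kernel. -/
theorem exists_probabilityMeasure_poisson_dilate {q : ℂ → ℂ}
    (hq : DifferentiableOn ℂ q (Metric.ball 0 1)) (hq0 : q 0 = 1)
    (hre : ∀ z ∈ Metric.ball (0 : ℂ) 1, 0 < (q z).re) {r : ℝ} (hr0 : 0 < r) (hr1 : r < 1) :
    ∃ σ : ProbabilityMeasure (Metric.sphere (0 : ℂ) 1), ∀ w ∈ Metric.ball (0 : ℂ) 1,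
      ∫ y, ((1 + w * (y : ℂ)) / (1 - w * (y : ℂ))).re ∂(σ : Measure (Metric.sphere (0 : ℂ) 1))
        = (q (r * w)).re := by
  have hmaps : ∀ z ∈ Metric.closedBall (0 : ℂ) 1, (r * z : ℂ) ∈ Metric.ball (0 : ℂ) 1 := by
    intro z hz
    simp only [mem_closedBall_zero_iff, mem_ball_zero_iff] at hz ⊢
    rw [norm_mul, Complex.norm_real, Real.norm_of_nonneg hr0.le]
    nlinarith [norm_nonneg z]
  have hqr : DifferentiableOn ℂ (fun z => q (r * z)) (Metric.closedBall 0 1) :=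
    hq.comp (by fun_prop) hmaps
  have hdc : DiffContOnCl ℂ (fun z => q (r * z)) (Metric.ball 0 1) :=
    DifferentiableOn.diffContOnCl (by rwa [closure_ball _ one_ne_zero])
  have hcirc : ∀ θ : ℝ, circleMap 0 1 θ ∈ Metric.closedBall (0 : ℂ) 1 := fun θ => by
    simp
  let d : ℝ → ℝ := fun θ => (2 * Real.pi)⁻¹ * (q (r * circleMap 0 1 θ)).re
  have hdcont : Continuous d := by
    have : Continuous fun θ => q (r * circleMap 0 1 θ) :=
      hqr.continuousOn.comp_continuous (continuous_circleMap 0 1) hcirc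
    exact continuous_const.mul (Complex.continuous_re.comp this)
  have hdpos : ∀ θ, 0 ≤ d θ := fun θ =>
    mul_nonneg (by positivity) (hre _ (hmaps _ (hcirc θ))).le
  -- The angle is reversed because the kernel is written with 1 - wy: it becomes the Poisson kernel
  -- at the boundary point 1/y.
  let φ : ℝ → Metric.sphere (0 : ℂ) 1 := fun θ => ⟨circleMap 0 1 (-θ), by simp⟩
  have hφ : Continuous φ := by
    exact ((continuous_circleMap 0 1).comp continuous_neg).subtype_mk _
  let m : Measure ℝ := (volume.restrict (Set.Ioc 0 (2 * Real.pi))).withDensity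
    (fun θ => ENNReal.ofReal (d θ))
  have hkey : ∀ g : ℝ → ℝ, ∫ θ, g θ ∂m = ∫ θ in (0 : ℝ)..2 * Real.pi, d θ * g θ := by
    intro g
    rw [integral_withDensity_eq_integral_toReal_smul (by fun_prop) (by simp),
      intervalIntegral.integral_of_le (by positivity)]
    simp [ENNReal.toReal_ofReal (hdpos _)]
  have hpoisson : ∀ w ∈ Metric.ball (0 : ℂ) 1,
      ∫ θ in (0 : ℝ)..2 * Real.pi,
        d θ * ((1 + w * circleMap 0 1 (-θ)) / (1 - w * circleMap 0 1 (-θ))).re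
          = (q (r * w)).re := by
    intro w hw
    have h1 := hdc.circleAverage_re_herglotzRieszKernel_smul' hw
    have hne : ∀ θ : ℝ, circleMap 0 1 θ ≠ 0 := fun θ => circleMap_ne_center one_ne_zero
    have hinv : ∀ θ : ℝ, circleMap 0 1 (-θ) = (circleMap 0 1 θ)⁻¹ := fun θ => by
      simp [circleMap, ← Complex.exp_neg]
    have hsub : ∀ θ : ℝ, circleMap 0 1 θ - w ≠ 0 := fun θ =>
      sub_ne_zero.2 (circleMap_ne_mem_ball hw θ)
    have hker : ∀ θ : ℝ, (1 + w * circleMap 0 1 (-θ)) / (1 - w * circleMap 0 1 (-θ))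
        = (circleMap 0 1 θ + w) / (circleMap 0 1 θ - w) := by
      intro θ
      have h2 := hne θ
      have h3 := hsub θ
      rw [hinv]
      have h4 : 1 - w * (circleMap 0 1 θ)⁻¹ ≠ 0 := by
        intro h
        apply h3
        field_simp at h
        rwa [mul_zero] at h
      rw [div_eq_div_iff h4 h3]
      field_simp
    simp only [hker]
    rw [Real.circleAverage_def] at h1
    have hcont : Continuous fun θ : ℝ =>
        ((circleMap 0 1 θ - 0 + (w - 0)) / (circleMap 0 1 θ - 0 - (w - 0))).re •
          q (r * circleMap 0 1 θ) := by
      have : Continuous fun θ => q (r * circleMap 0 1 θ) :=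
        hqr.continuousOn.comp_continuous (continuous_circleMap 0 1) hcirc
      refine (Complex.continuous_re.comp (Continuous.div ?_ ?_ ?_)).smul this
      · exact ((continuous_circleMap 0 1).sub continuous_const).add continuous_const
      · exact ((continuous_circleMap 0 1).sub continuous_const).sub continuous_const
      · simpa using hsub
    have h5 := Complex.reCLM.intervalIntegral_comp_comm
      (hcont.intervalIntegrable (μ := volume) 0 (2 * Real.pi))
    rw [← h1, Complex.smul_re]
    simp only [Complex.reCLM_apply] at h5
    rw [← h5, smul_eq_mul, ← intervalIntegral.integral_const_mul]
    refine intervalIntegral.integral_congr fun θ _ => ?_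
    simp only [d, Complex.smul_re, sub_zero, smul_eq_mul]
    ring
  -- The total mass is the Poisson formula at w = 0, where the kernel is 1 and q(0) = 1.
  have hmass : m Set.univ = 1 := by
    rw [withDensity_apply _ MeasurableSet.univ, Measure.restrict_univ,
      ← ofReal_integral_eq_lintegral_ofReal ?_ (Eventually.of_forall hdpos)]
    · have := hpoisson 0 (by simp)
      simp only [zero_mul, add_zero, sub_zero, div_one, Complex.one_re, mul_one, mul_zero,
        hq0] at this
      rw [intervalIntegral.integral_of_le (by positivity)] at this
      rw [this, ENNReal.ofReal_one]
    · exact (hdcont.integrableOn_Icc).mono_set Set.Ioc_subset_Icc_self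
  have hm : IsProbabilityMeasure m := ⟨hmass⟩
  refine ⟨⟨m.map φ, Measure.isProbabilityMeasure_map hφ.measurable.aemeasurable⟩, fun w hw => ?_⟩
  rw [ProbabilityMeasure.coe_mk, integral_map hφ.measurable.aemeasurable
    (Measurable.aestronglyMeasurable (by fun_prop)), hkey]
  exact hpoisson w hw

theorem one_sub_mul_ne_zero_of_mem_ball {z : ℂ} (hz : z ∈ Metric.ball (0 : ℂ) 1)
    (y : Metric.sphere (0 : ℂ) 1) : 1 - z * (y : ℂ) ≠ 0 := by
  intro h
  have h1 : ‖z * (y : ℂ)‖ = 1 := by rw [← sub_eq_zero.1 h, norm_one]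
  rw [norm_mul, norm_eq_of_mem_sphere, mul_one] at h1
  exact (mem_ball_zero_iff.1 hz).ne h1

theorem one_sub_norm_le_norm_one_sub_mul (z : ℂ) (y : Metric.sphere (0 : ℂ) 1) :
    1 - ‖z‖ ≤ ‖1 - z * (y : ℂ)‖ := by
  have := norm_sub_norm_le (1 : ℂ) (z * y)
  rwa [norm_mul, norm_eq_of_mem_sphere, mul_one, norm_one] at this

theorem continuous_herglotzKernel {z : ℂ} (hz : z ∈ Metric.ball (0 : ℂ) 1) :
    Continuous fun y : Metric.sphere (0 : ℂ) 1 => (1 + z * (y : ℂ)) / (1 - z * (y : ℂ)) :=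
  Continuous.div (by fun_prop) (by fun_prop) (one_sub_mul_ne_zero_of_mem_ball hz)

theorem integrable_herglotzKernel {z : ℂ} (hz : z ∈ Metric.ball (0 : ℂ) 1)
    (σ : Measure (Metric.sphere (0 : ℂ) 1)) [IsFiniteMeasure σ] :
    Integrable (fun y : Metric.sphere (0 : ℂ) 1 => (1 + z * (y : ℂ)) / (1 - z * (y : ℂ))) σ :=
  (continuous_herglotzKernel hz).integrable_of_hasCompactSupport
    (HasCompactSupport.of_compactSpace _)

theorem differentiableOn_integral_herglotzKernel
    (σ : Measure (Metric.sphere (0 : ℂ) 1)) [IsFiniteMeasure σ] :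
    DifferentiableOn ℂ (fun z => ∫ y : Metric.sphere (0 : ℂ) 1,
      (1 + z * (y : ℂ)) / (1 - z * (y : ℂ)) ∂σ) (Metric.ball 0 1) := by
  intro z hz
  have hz' : ‖z‖ < 1 := mem_ball_zero_iff.1 hz
  set ρ : ℝ := (1 + ‖z‖) / 2 with hρ
  have hρ1 : ρ < 1 := by linarith
  have hs : Metric.ball (0 : ℂ) ρ ∈ 𝓝 z :=
    Metric.isOpen_ball.mem_nhds (mem_ball_zero_iff.2 (by linarith))
  refine (hasDerivAt_integral_of_dominated_loc_of_deriv_le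
    (μ := σ)
    (F := fun (z : ℂ) (y : Metric.sphere (0 : ℂ) 1) => (1 + z * (y : ℂ)) / (1 - z * (y : ℂ)))
    (F' := fun z y => 2 * (y : ℂ) / (1 - z * (y : ℂ)) ^ 2)
    (bound := fun _ => 2 / (1 - ρ) ^ 2) hs
    (Eventually.of_forall fun x => Measurable.aestronglyMeasurable (by fun_prop))
    (integrable_herglotzKernel hz σ) (Measurable.aestronglyMeasurable (by fun_prop))
    (Eventually.of_forall fun y x hx => ?_) (integrable_const _)
    (Eventually.of_forall fun y x hx => ?_)).2.differentiableAt.differentiableWithinAt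
  · have hx' : ‖x‖ < ρ := mem_ball_zero_iff.1 hx
    have := one_sub_norm_le_norm_one_sub_mul x y
    rw [norm_div, norm_mul, norm_eq_of_mem_sphere, norm_pow, mul_one, Complex.norm_ofNat]
    have h0 : 0 < 1 - ρ := by linarith
    gcongr
    linarith
  · have hx' : x ∈ Metric.ball (0 : ℂ) 1 := Metric.ball_subset_ball hρ1.le hx
    have h1 := (((hasDerivAt_id' x).mul_const (y : ℂ)).const_add 1).div
      (((hasDerivAt_id' x).mul_const (y : ℂ)).const_sub 1) (one_sub_mul_ne_zero_of_mem_ball hx' y)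
    refine h1.congr_deriv ?_
    ring

/-- **Herglotz representation** of a holomorphic function on the unit disk with positive real
part and value `1` at the origin. -/
theorem exists_herglotz_measure {q : ℂ → ℂ}
    (hq : DifferentiableOn ℂ q (Metric.ball 0 1)) (hq0 : q 0 = 1)
    (hre : ∀ z ∈ Metric.ball (0 : ℂ) 1, 0 < (q z).re) :
    ∃ σ : Measure (Metric.sphere (0 : ℂ) 1), IsProbabilityMeasure σ ∧
      ∀ z ∈ Metric.ball (0 : ℂ) 1,
        q z = ∫ y : Metric.sphere (0 : ℂ) 1, (1 + z * (y : ℂ)) / (1 - z * (y : ℂ)) ∂σ := by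
  have hex : ∀ r : ℝ, ∃ σ : ProbabilityMeasure (Metric.sphere (0 : ℂ) 1), 0 < r → r < 1 →
      ∀ w ∈ Metric.ball (0 : ℂ) 1,
        ∫ y, ((1 + w * (y : ℂ)) / (1 - w * (y : ℂ))).re ∂(σ : Measure (Metric.sphere (0 : ℂ) 1))
          = (q (r * w)).re := by
    intro r
    by_cases h : 0 < r ∧ r < 1
    · obtain ⟨σ, hσ⟩ := exists_probabilityMeasure_poisson_dilate hq hq0 hre h.1 h.2
      exact ⟨σ, fun _ _ => hσ⟩
    · obtain ⟨σ, -⟩ := exists_probabilityMeasure_poisson_dilate hq hq0 hre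
        (r := 1 / 2) (by norm_num) (by norm_num)
      exact ⟨σ, fun h0 h1 => absurd ⟨h0, h1⟩ h⟩
  choose S hS using hex
  -- An ultrafilter finer than r → 1⁻ replaces a weakly convergent subsequence: its image converges
  -- in the compact space of probability measures.
  let U : Ultrafilter ℝ := Ultrafilter.of (𝓝[<] (1 : ℝ))
  have hU : (U : Filter ℝ) ≤ 𝓝[<] (1 : ℝ) := Ultrafilter.of_le _
  obtain ⟨σ, -, hσ⟩ := isCompact_iff_ultrafilter_le_nhds.1
    (isCompact_univ (X := ProbabilityMeasure (Metric.sphere (0 : ℂ) 1))) (U.map S) (by simp)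
  have hlim : Tendsto S U (𝓝 σ) := hσ
  have hreal : ∀ w ∈ Metric.ball (0 : ℂ) 1,
      ∫ y, ((1 + w * (y : ℂ)) / (1 - w * (y : ℂ))).re ∂(σ : Measure (Metric.sphere (0 : ℂ) 1))
        = (q w).re := by
    intro w hw
    have h1 := ProbabilityMeasure.tendsto_iff_forall_integral_tendsto.1 hlim
      (BoundedContinuousFunction.mkOfCompact
        ⟨_, Complex.continuous_re.comp (continuous_herglotzKernel hw)⟩)
    simp only [BoundedContinuousFunction.mkOfCompact_apply, ContinuousMap.coe_mk,
      Function.comp_apply] at h1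
    have h2 : Tendsto (fun r : ℝ => (q (r * w)).re) (𝓝[<] 1) (𝓝 (q w).re) := by
      have hc : ContinuousAt q ((1 : ℝ) * w) := by
        simpa using (hq.differentiableAt (Metric.isOpen_ball.mem_nhds hw)).continuousAt
      have h3 : ContinuousAt (fun r : ℝ => (q (r * w)).re) 1 :=
        Complex.continuous_re.continuousAt.comp
          (ContinuousAt.comp (f := fun r : ℝ => (r : ℂ) * w) hc (by fun_prop))
      have h4 := h3.tendsto
      simp only [Complex.ofReal_one, one_mul] at h4
      exact h4.mono_left nhdsWithin_le_nhds
    refine tendsto_nhds_unique_of_eventuallyEq h1 (h2.mono_left hU) ?_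
    have hev : ∀ᶠ r : ℝ in 𝓝[<] 1, 0 < r ∧ r < 1 :=
      Ioo_mem_nhdsLT one_pos
    filter_upwards [hU hev] with r hr
    exact hS r hr.1 hr.2 w hw
  refine ⟨σ, inferInstance, ?_⟩
  set F : ℂ → ℂ := fun z => ∫ y : Metric.sphere (0 : ℂ) 1,
    (1 + z * (y : ℂ)) / (1 - z * (y : ℂ)) ∂(σ : Measure (Metric.sphere (0 : ℂ) 1)) with hF
  have hFd : DifferentiableOn ℂ F (Metric.ball 0 1) := differentiableOn_integral_herglotzKernel _
  have hFre : ∀ z ∈ Metric.ball (0 : ℂ) 1, (F z).re = (q z).re := by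
    intro z hz
    rw [← hreal z hz]
    exact (Complex.reCLM.integral_comp_comm (integrable_herglotzKernel hz _)).symm
  -- The two functions have equal real parts, so they differ by a constant, which vanishes by
  -- comparison at 0.
  have han := (hq.sub hFd).analyticOnNhd Metric.isOpen_ball
  obtain ⟨c, hc⟩ := han.eq_const_of_re_eq_const (c₀ := 0)
    (fun z hz => by simp [hFre z hz]) Metric.isOpen_ball
    ((convex_ball (0 : ℂ) 1).isConnected ⟨0, by simp⟩)
  have hc0 : c = 0 := by
    rw [← hc 0 (by simp)]
    simp [hF, hq0]
  intro z hz
  have := hc z hz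
  rw [hc0] at this
  exact sub_eq_zero.1 this

/-! ### Arguments of points in a half-plane -/

theorem re_one_sub_pos_of_norm_lt_one {z : ℂ} (hz : ‖z‖ < 1) : 0 < (1 - z).re := by
  have := (Complex.abs_re_le_norm z).trans_lt hz
  rw [Complex.sub_re, Complex.one_re]
  linarith [(abs_lt.1 this).2]

theorem re_one_sub_mul_pos_of_mem_ball {z : ℂ} (hz : z ∈ Metric.ball (0 : ℂ) 1)
    (y : Metric.sphere (0 : ℂ) 1) : 0 < (1 - z * (y : ℂ)).re := by
  apply re_one_sub_pos_of_norm_lt_one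
  rw [norm_mul, norm_eq_of_mem_sphere, mul_one]
  exact mem_ball_zero_iff.1 hz

theorem re_one_sub_pos_of_mem_sphere {y : ℂ} (hy : ‖y‖ = 1) (hy1 : y ≠ 1) : 0 < (1 - y).re := by
  have h1 : y.re ^ 2 + y.im ^ 2 = 1 := by
    have := Complex.normSq_eq_norm_sq y
    rw [hy, Complex.normSq_apply] at this
    linarith
  rw [Complex.sub_re, Complex.one_re]
  by_contra h
  have h2 : y.re = 1 := by nlinarith [sq_nonneg y.im]
  have h3 : y.im = 0 := by
    rw [h2] at h1
    have : y.im ^ 2 = 0 := by linarith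
    exact pow_eq_zero_iff two_ne_zero |>.1 this
  exact hy1 (Complex.ext h2 h3)

theorem abs_arg_lt_pi_div_two_of_re_pos {z : ℂ} (hz : 0 < z.re) : |z.arg| < Real.pi / 2 :=
  Complex.abs_arg_lt_pi_div_two_iff.2 (Or.inl hz)

theorem abs_arg_one_sub_mul_lt {z : ℂ} (hz : z ∈ Metric.ball (0 : ℂ) 1)
    (y : Metric.sphere (0 : ℂ) 1) : |(1 - z * (y : ℂ)).arg| < Real.pi / 2 :=
  abs_arg_lt_pi_div_two_of_re_pos (re_one_sub_mul_pos_of_mem_ball hz y)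

/-- The logarithm of a Möbius map from the disk to a half-plane bounded by a line through `0`
has imaginary part in an interval of length `π`. -/
theorem abs_arg_add_arg_sub_arg_lt {z y : ℂ} (hz : ‖z‖ < 1) (hy : ‖y‖ = 1) :
    |(1 - z).arg - (1 - z * y).arg + (1 - y).arg| < Real.pi / 2 := by
  have hzy : ‖z * y‖ < 1 := by rwa [norm_mul, hy, mul_one]
  rcases eq_or_ne y 1 with rfl | hy1
  · simp [Real.pi_pos]
  have hA := re_one_sub_pos_of_norm_lt_one hz
  have hC := re_one_sub_pos_of_norm_lt_one hzy
  have hB := re_one_sub_pos_of_mem_sphere hy hy1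
  have hyy : y.re ^ 2 + y.im ^ 2 = 1 := by
    have := Complex.normSq_eq_norm_sq y
    rw [hy, Complex.normSq_apply] at this
    linarith
  have hzz : z.re ^ 2 + z.im ^ 2 < 1 := by
    have := Complex.normSq_eq_norm_sq z
    rw [Complex.normSq_apply] at this
    nlinarith [norm_nonneg z]
  have hre : 0 < ((1 - z) * (1 - y) * (starRingEnd ℂ) (1 - z * y)).re := by
    have : ((1 - z) * (1 - y) * (starRingEnd ℂ) (1 - z * y)).re
        = (1 - (z.re ^ 2 + z.im ^ 2)) * (1 - y.re) := by
      simp only [Complex.mul_re, Complex.mul_im, Complex.sub_re, Complex.sub_im, Complex.one_re,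
        Complex.one_im, Complex.conj_re, Complex.conj_im]
      linear_combination (z.re - z.re ^ 2 - z.im ^ 2) * hyy
    rw [this]
    simp only [Complex.sub_re, Complex.one_re] at hB
    exact mul_pos (by linarith) hB
  set θ := (1 - z).arg - (1 - z * y).arg + (1 - y).arg with hθ
  have hcos : 0 < Real.cos θ := by
    have h1 : (1 - z) * (1 - y) * (starRingEnd ℂ) (1 - z * y)
        = ((‖1 - z‖ * ‖1 - y‖ * ‖1 - z * y‖ : ℝ) : ℂ) * Complex.exp (θ * Complex.I) := by
      have h2 : (starRingEnd ℂ) (1 - z * y)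
          = ‖1 - z * y‖ * Complex.exp (-((1 - z * y).arg * Complex.I)) := by
        conv_lhs => rw [← Complex.norm_mul_exp_arg_mul_I (1 - z * y)]
        rw [map_mul, Complex.conj_ofReal, ← Complex.exp_conj]
        simp
      rw [h2]
      conv_lhs => rw [← Complex.norm_mul_exp_arg_mul_I (1 - z),
        ← Complex.norm_mul_exp_arg_mul_I (1 - y)]
      have h3 : Complex.exp (θ * Complex.I) = Complex.exp ((1 - z).arg * Complex.I) *
          Complex.exp ((1 - y).arg * Complex.I) *
          Complex.exp (-((1 - z * y).arg * Complex.I)) := by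
        rw [← Complex.exp_add, ← Complex.exp_add, hθ]
        congr 1
        push_cast
        ring
      rw [h3]
      push_cast
      ring
    rw [h1, Complex.re_ofReal_mul, Complex.exp_ofReal_mul_I_re] at hre
    exact pos_of_mul_pos_right hre (by positivity)
  have h1 := abs_lt.1 (abs_arg_lt_pi_div_two_of_re_pos hA)
  have h2 := abs_lt.1 (abs_arg_lt_pi_div_two_of_re_pos hB)
  have h3 := abs_lt.1 (abs_arg_lt_pi_div_two_of_re_pos hC)
  -- Three arguments below π/2 give |θ| < 3π/2, and on [π/2, 3π/2] the cosine is nonpositive.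
  by_contra h
  rw [not_lt] at h
  have h4 := Real.cos_nonpos_of_pi_div_two_le_of_le h (by
    rw [abs_le]
    constructor <;> linarith [h1.1, h1.2, h2.1, h2.2, h3.1, h3.2])
  rw [Real.cos_abs] at h4
  linarith

/-! ### Integrals of bounded functions that vanish at a point -/

section AwayFromAtom

variable {X : Type*} [MeasurableSpace X]
  {σ : Measure X} [IsProbabilityMeasure σ] {g : X → ℝ} {c : ℝ} {x : X}

theorem integrable_of_abs_lt (hg : Measurable g) (hc : ∀ y, |g y| < c) : Integrable g σ :=
  Integrable.of_bound hg.aestronglyMeasurable c (Eventually.of_forall fun y => (hc y).le)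

variable [MeasurableSingletonClass X]

/-- A function vanishing at an atom only contributes through the rest of the mass. -/
theorem abs_integral_lt_mul_one_sub_of_apply_eq_zero (hg : Measurable g) (hc : ∀ y, |g y| < c)
    (hx : g x = 0) (hσ : σ.real {x} < 1) : |∫ y, g y ∂σ| < c * (1 - σ.real {x}) := by
  have hint := (integrable_of_abs_lt (σ := σ) hg hc).abs
  have hmeas : MeasurableSet ({x}ᶜ : Set X) := (measurableSet_singleton x).compl
  have hind : Integrable (({x}ᶜ : Set X).indicator fun _ => c) σ :=
    (integrable_const c).indicator hmeas
  have hcompl : σ.real {x}ᶜ = 1 - σ.real {x} := probReal_compl_eq_one_sub (measurableSet_singleton x)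
  have htot : ∫ y, ({x}ᶜ : Set X).indicator (fun _ => c) y ∂σ = c * (1 - σ.real {x}) := by
    rw [integral_indicator hmeas, setIntegral_const, hcompl, smul_eq_mul, mul_comm]
  have hpos : 0 < ∫ y, (({x}ᶜ : Set X).indicator (fun _ => c) y - |g y|) ∂σ := by
    have hdiff : Integrable (fun y => ({x}ᶜ : Set X).indicator (fun _ => c) y - |g y|) σ :=
      hind.sub hint
    rw [integral_pos_iff_support_of_nonneg ?_ hdiff]
    · have hsub : ({x}ᶜ : Set X) ⊆ Function.support
          fun y => ({x}ᶜ : Set X).indicator (fun _ => c) y - |g y| := by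
        intro y hy
        rw [Function.mem_support, Set.indicator_of_mem hy]
        exact (sub_pos.2 (hc y)).ne'
      refine lt_of_lt_of_le ?_ (measure_mono hsub)
      have : 0 < σ.real {x}ᶜ := by rw [hcompl]; linarith
      exact (ENNReal.toReal_pos_iff.1 this).1
    · intro y
      by_cases hy : y = x
      · simp [hy, hx]
      · simpa [hy] using (hc y).le
  rw [integral_sub hind hint, htot] at hpos
  exact (abs_integral_le_integral_abs).trans_lt (by linarith)

theorem ae_eq_of_measureReal_singleton_eq_one (hσ : σ.real {x} = 1) : ∀ᵐ y ∂σ, y = x := by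
  have h : σ.real {x}ᶜ = 0 := by
    rw [probReal_compl_eq_one_sub (measurableSet_singleton x), hσ, sub_self]
  exact (measureReal_eq_zero_iff (measure_ne_top _ _)).1 h

theorem integral_eq_apply_of_measureReal_singleton_eq_one {E : Type*} [NormedAddCommGroup E]
    [NormedSpace ℝ E] [CompleteSpace E] (hσ : σ.real {x} = 1) (G : X → E) :
    ∫ y, G y ∂σ = G x := by
  rw [integral_congr_ae (g := fun _ => G x)
    ((ae_eq_of_measureReal_singleton_eq_one hσ).mono fun y hy => by rw [hy])]
  simp

theorem abs_integral_lt_of_apply_eq_zero (hg : Measurable g) (hc : ∀ y, |g y| < c)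
    (hx : g x = 0) : |∫ y, g y ∂σ| < c := by
  have hc0 : 0 < c := (abs_nonneg _).trans_lt (hc x)
  rcases (measureReal_le_one (μ := σ) (s := {x})).lt_or_eq with h | h
  · refine (abs_integral_lt_mul_one_sub_of_apply_eq_zero hg hc hx h).trans_le ?_
    nlinarith [measureReal_nonneg (μ := σ) (s := {x})]
  · rwa [integral_eq_apply_of_measureReal_singleton_eq_one h, hx, abs_zero]

end AwayFromAtom

/-! ### The logarithmic potential and its radial limits -/

section LogPotential

variable (σ : Measure (Metric.sphere (0 : ℂ) 1))

/-- The logarithmic potential `∫ log (1 - z y) dσ(y)` of a measure on the unit circle. -/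
noncomputable def logPotential (z : ℂ) : ℂ :=
  ∫ y : Metric.sphere (0 : ℂ) 1, Complex.log (1 - z * (y : ℂ)) ∂σ

theorem logPotential_zero : logPotential σ 0 = 0 := by
  simp [logPotential]

variable [IsProbabilityMeasure σ]

theorem integrable_log_one_sub_mul {z : ℂ} (hz : z ∈ Metric.ball (0 : ℂ) 1) :
    Integrable (fun y : Metric.sphere (0 : ℂ) 1 => Complex.log (1 - z * (y : ℂ))) σ := by
  refine Continuous.integrable_of_hasCompactSupport ?_ (HasCompactSupport.of_compactSpace _)
  refine Continuous.clog (by fun_prop) fun y => Or.inl (re_one_sub_mul_pos_of_mem_ball hz y)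

theorem im_logPotential {z : ℂ} (hz : z ∈ Metric.ball (0 : ℂ) 1) :
    (logPotential σ z).im = ∫ y : Metric.sphere (0 : ℂ) 1, (1 - z * (y : ℂ)).arg ∂σ := by
  have := Complex.imCLM.integral_comp_comm (integrable_log_one_sub_mul σ hz)
  simp only [Complex.imCLM_apply, Complex.log_im] at this
  exact this.symm

theorem hasDerivAt_logPotential {z : ℂ} (hz : z ∈ Metric.ball (0 : ℂ) 1) :
    HasDerivAt (logPotential σ)
      (∫ y : Metric.sphere (0 : ℂ) 1, -(y : ℂ) / (1 - z * (y : ℂ)) ∂σ) z := by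
  have hz' : ‖z‖ < 1 := mem_ball_zero_iff.1 hz
  set ρ : ℝ := (1 + ‖z‖) / 2 with hρ
  have hρ1 : ρ < 1 := by linarith
  have hs : Metric.ball (0 : ℂ) ρ ∈ 𝓝 z :=
    Metric.isOpen_ball.mem_nhds (mem_ball_zero_iff.2 (by linarith))
  refine (hasDerivAt_integral_of_dominated_loc_of_deriv_le
    (μ := σ)
    (F := fun (z : ℂ) (y : Metric.sphere (0 : ℂ) 1) => Complex.log (1 - z * (y : ℂ)))
    (F' := fun z y => -(y : ℂ) / (1 - z * (y : ℂ)))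
    (bound := fun _ => 1 / (1 - ρ)) hs
    (Eventually.of_forall fun x => Measurable.aestronglyMeasurable (by fun_prop))
    (integrable_log_one_sub_mul σ hz) (Measurable.aestronglyMeasurable (by fun_prop))
    (Eventually.of_forall fun y x hx => ?_) (integrable_const _)
    (Eventually.of_forall fun y x hx => ?_)).2
  · have hx' : ‖x‖ < ρ := mem_ball_zero_iff.1 hx
    have := one_sub_norm_le_norm_one_sub_mul x y
    rw [norm_div, norm_neg, norm_eq_of_mem_sphere]
    have h0 : 0 < 1 - ρ := by linarith
    gcongr
    linarith
  · have hx' : x ∈ Metric.ball (0 : ℂ) 1 := Metric.ball_subset_ball hρ1.le hx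
    have h1 := (((hasDerivAt_id' x).mul_const (y : ℂ)).const_sub 1).clog
      (Or.inl (re_one_sub_mul_pos_of_mem_ball hx' y))
    refine h1.congr_deriv ?_
    ring

/-- Pointwise, -zy/(1-zy) = (1 - (1+zy)/(1-zy))/2. This links the Herglotz integral to a logarithmic
derivative. -/
theorem mul_deriv_logPotential {z : ℂ} (hz : z ∈ Metric.ball (0 : ℂ) 1) :
    z * deriv (logPotential σ) z
      = (1 - ∫ y : Metric.sphere (0 : ℂ) 1, (1 + z * (y : ℂ)) / (1 - z * (y : ℂ)) ∂σ) / 2 := by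
  have h1 : ∀ c : ℂ, 1 - c = ∫ _ : Metric.sphere (0 : ℂ) 1, (1 : ℂ) ∂σ - c := by simp
  rw [(hasDerivAt_logPotential σ hz).deriv, ← integral_const_mul]
  rw [h1, ← integral_sub (integrable_const _) (integrable_herglotzKernel hz σ),
    ← integral_div]
  refine integral_congr_ae (Eventually.of_forall fun y => ?_)
  have := one_sub_mul_ne_zero_of_mem_ball hz y
  simp only
  field_simp
  ring

theorem ofReal_mem_ball_of_mem_Ioo {r : ℝ} (hr : r ∈ Set.Ioo (0 : ℝ) 1) :
    (r : ℂ) ∈ Metric.ball (0 : ℂ) 1 := by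
  rw [mem_ball_zero_iff, Complex.norm_real, Real.norm_of_nonneg hr.1.le]
  exact hr.2

/-- The radial growth of a Herglotz integral at `1` detects the mass of the point `1`. -/
theorem tendsto_one_sub_mul_integral_herglotzKernel :
    Tendsto (fun r : ℝ => (1 - (r : ℂ)) *
        ∫ y : Metric.sphere (0 : ℂ) 1, (1 + (r : ℂ) * (y : ℂ)) / (1 - (r : ℂ) * (y : ℂ)) ∂σ)
      (𝓝[<] 1) (𝓝 (2 * (σ.real {⟨1, by simp⟩} : ℂ))) := by
  set o : Metric.sphere (0 : ℂ) 1 := ⟨1, by simp⟩ with ho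
  have hlim : ∫ y, ({o} : Set (Metric.sphere (0 : ℂ) 1)).indicator (fun _ => (2 : ℂ)) y ∂σ
      = 2 * (σ.real {o} : ℂ) := by
    rw [integral_indicator (measurableSet_singleton o), setIntegral_const, Complex.real_smul,
      mul_comm]
  rw [← hlim]
  simp_rw [← integral_const_mul]
  have hIoo : ∀ᶠ r : ℝ in 𝓝[<] 1, r ∈ Set.Ioo (0 : ℝ) 1 := Ioo_mem_nhdsLT one_pos
  refine tendsto_integral_filter_of_dominated_convergence (fun _ => 2)
    (Eventually.of_forall fun r => Measurable.aestronglyMeasurable (by fun_prop)) ?_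
    (integrable_const _) (Eventually.of_forall fun y => ?_)
  · filter_upwards [hIoo] with r hr
    refine Eventually.of_forall fun y => ?_
    have h1 := one_sub_norm_le_norm_one_sub_mul (r : ℂ) y
    have h2 := norm_pos_iff.2 (one_sub_mul_ne_zero_of_mem_ball (ofReal_mem_ball_of_mem_Ioo hr) y)
    rw [Complex.norm_real, Real.norm_of_nonneg hr.1.le] at h1
    have h3 : ‖1 - (r : ℂ)‖ = 1 - r := by
      rw [← Complex.ofReal_one, ← Complex.ofReal_sub, Complex.norm_real,
        Real.norm_of_nonneg (by linarith [hr.2])]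
    have h4 : ‖1 + (r : ℂ) * (y : ℂ)‖ ≤ 2 := by
      refine (norm_add_le _ _).trans ?_
      rw [norm_one, norm_mul, norm_eq_of_mem_sphere, Complex.norm_real,
        Real.norm_of_nonneg hr.1.le]
      linarith [hr.2]
    -- The bound 2 works because |1+ry| ≤ 2 and |1-ry| ≥ 1-r.
    rw [norm_mul, norm_div, h3, ← mul_div_assoc, div_le_iff₀ h2]
    have h5 : 0 ≤ 1 - r := by linarith [hr.2]
    nlinarith [norm_nonneg (1 + (r : ℂ) * (y : ℂ))]
  · by_cases hy : y = o
    · rw [hy, Set.indicator_of_mem (Set.mem_singleton o)]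
      have h1 : Tendsto (fun r : ℝ => 1 + (r : ℂ)) (𝓝[<] 1) (𝓝 2) := by
        have : ContinuousAt (fun r : ℝ => 1 + (r : ℂ)) 1 := by fun_prop
        have h2 := this.tendsto
        norm_num at h2
        exact h2.mono_left nhdsWithin_le_nhds
      refine h1.congr' ?_
      filter_upwards [hIoo] with r hr
      have h3 : 1 - (r : ℂ) ≠ 0 := by
        simpa [ho] using one_sub_mul_ne_zero_of_mem_ball (ofReal_mem_ball_of_mem_Ioo hr) o
      simp only [ho, mul_one]
      field_simp
    · rw [Set.indicator_of_notMem (by simpa using hy)]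
      have hy1 : 1 - (y : ℂ) ≠ 0 := fun h => hy (Subtype.ext (sub_eq_zero.1 h).symm)
      have : ContinuousAt (fun r : ℝ =>
          (1 - (r : ℂ)) * ((1 + (r : ℂ) * (y : ℂ)) / (1 - (r : ℂ) * (y : ℂ)))) 1 := by
        refine ContinuousAt.mul (by fun_prop) (ContinuousAt.div (by fun_prop) (by fun_prop) ?_)
        simpa using hy1
      have h2 := this.tendsto
      simp only [Complex.ofReal_one, sub_self, zero_mul] at h2
      exact h2.mono_left nhdsWithin_le_nhds

/-- The arguments are bounded by π/2, so dominated convergence applies. At y = 1 the convention arg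
0 = 0 gives the correct limit, since arg(1-r) = 0 for r < 1. -/
theorem tendsto_im_logPotential :
    Tendsto (fun r : ℝ => (logPotential σ (r : ℂ)).im) (𝓝[<] 1)
      (𝓝 (∫ y : Metric.sphere (0 : ℂ) 1, (1 - (y : ℂ)).arg ∂σ)) := by
  have hIoo : ∀ᶠ r : ℝ in 𝓝[<] 1, r ∈ Set.Ioo (0 : ℝ) 1 := Ioo_mem_nhdsLT one_pos
  have h : Tendsto (fun r : ℝ => ∫ y : Metric.sphere (0 : ℂ) 1, (1 - (r : ℂ) * (y : ℂ)).arg ∂σ)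
      (𝓝[<] 1) (𝓝 (∫ y : Metric.sphere (0 : ℂ) 1, (1 - (y : ℂ)).arg ∂σ)) := by
    refine tendsto_integral_filter_of_dominated_convergence (fun _ => Real.pi / 2)
      (Eventually.of_forall fun r => Measurable.aestronglyMeasurable (by fun_prop)) ?_
      (integrable_const _) (Eventually.of_forall fun y => ?_)
    · filter_upwards [hIoo] with r hr
      exact Eventually.of_forall fun y =>
        (abs_arg_one_sub_mul_lt (ofReal_mem_ball_of_mem_Ioo hr) y).le
    · by_cases hy : (y : ℂ) = 1
      · rw [hy, sub_self, Complex.arg_zero]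
        refine tendsto_const_nhds.congr' ?_
        filter_upwards [hIoo] with r hr
        rw [mul_one, ← Complex.ofReal_one, ← Complex.ofReal_sub,
          Complex.arg_ofReal_of_nonneg (by linarith [hr.2])]
      · have h1 : ContinuousAt Complex.arg (1 - ((1 : ℝ) : ℂ) * (y : ℂ)) := by
          apply Complex.continuousAt_arg
          rw [Complex.ofReal_one, one_mul]
          exact Or.inl (re_one_sub_pos_of_mem_sphere (norm_eq_of_mem_sphere y) hy)
        have h2 : ContinuousAt (fun r : ℝ => (1 - (r : ℂ) * (y : ℂ)).arg) 1 :=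
          ContinuousAt.comp (f := fun r : ℝ => 1 - (r : ℂ) * (y : ℂ)) h1 (by fun_prop)
        have h3 := h2.tendsto
        simp only [Complex.ofReal_one, one_mul] at h3
        exact h3.mono_left nhdsWithin_le_nhds
  refine h.congr' ?_
  filter_upwards [hIoo] with r hr
  exact (im_logPotential σ (ofReal_mem_ball_of_mem_Ioo hr)).symm

end LogPotential

/-! ### From a strip for the logarithm to subordination -/

namespace SpiralBoundary

/-- The real part equals cos a · (1-|z|²). The conjugated factor is e^{ia} times the denominator in
`h`, so the base of the power, rotated by e^{-ia}, lies in the right half-plane. -/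
theorem re_sub_div_add_base_pos {a : ℝ} (ha : |a| < Real.pi / 2) {z : ℂ} (hz : ‖z‖ < 1) :
    0 < ((1 - z) * (starRingEnd ℂ)
      (Complex.exp (a * Complex.I) + Complex.exp (-(a * Complex.I)) * z)).re := by
  have hcos : 0 < Real.cos a := Real.cos_pos_of_mem_Ioo (abs_lt.1 ha)
  have hzz : z.re ^ 2 + z.im ^ 2 < 1 := by
    have := Complex.normSq_eq_norm_sq z
    rw [Complex.normSq_apply] at this
    nlinarith [norm_nonneg z]
  have hneg : Complex.exp (-(a * Complex.I)) = Complex.exp (((-a : ℝ) : ℂ) * Complex.I) := by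
    push_cast
    ring_nf
  have : ((1 - z) * (starRingEnd ℂ)
      (Complex.exp (a * Complex.I) + Complex.exp (-(a * Complex.I)) * z)).re
      = Real.cos a * (1 - (z.re ^ 2 + z.im ^ 2)) := by
    rw [hneg]
    simp only [Complex.mul_re, Complex.mul_im, Complex.sub_re, Complex.sub_im, Complex.one_re,
      Complex.one_im, Complex.conj_re, Complex.conj_im, Complex.add_re, Complex.add_im,
      Complex.exp_ofReal_mul_I_re, Complex.exp_ofReal_mul_I_im, Real.cos_neg, Real.sin_neg]
    ring
  rw [this]
  exact mul_pos hcos (by linarith)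

theorem one_add_exp_mul_ne_zero {a : ℝ} {z : ℂ} (hz : ‖z‖ < 1) :
    1 + Complex.exp (-2 * Complex.I * (a : ℂ)) * z ≠ 0 := by
  intro h
  have h1 : ‖Complex.exp (-2 * Complex.I * (a : ℂ)) * z‖ = 1 := by
    rw [← norm_neg, ← eq_neg_of_add_eq_zero_left h, norm_one]
  rw [norm_mul, Complex.norm_exp] at h1
  simp at h1
  linarith

theorem exp_neg_two_mul_I_mul (a : ℝ) : Complex.exp (-2 * Complex.I * (a : ℂ))
    = Complex.exp (-(a * Complex.I)) * Complex.exp (-(a * Complex.I)) := by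
  rw [← Complex.exp_add]
  ring_nf

theorem exp_neg_mul_I_mul_exp_mul_I (a : ℝ) :
    Complex.exp (-(a * Complex.I)) * Complex.exp (a * Complex.I) = 1 := by
  rw [← Complex.exp_add, neg_add_cancel, Complex.exp_zero]

theorem h_base_mem_slitPlane {a : ℝ} (ha : |a| < Real.pi / 2) {z : ℂ} (hz : ‖z‖ < 1) :
    (1 - z) / (1 + Complex.exp (-2 * Complex.I * (a : ℂ)) * z) ∈ Complex.slitPlane := by
  have hcos : 0 < Real.cos a := Real.cos_pos_of_mem_Ioo (abs_lt.1 ha)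
  have hpos := re_sub_div_add_base_pos ha hz
  set d := Complex.exp (a * Complex.I) + Complex.exp (-(a * Complex.I)) * z with hd
  have hne := one_add_exp_mul_ne_zero (a := a) hz
  by_contra hns
  rw [Complex.mem_slitPlane_iff, not_or, not_lt, not_not] at hns
  set b := (1 - z) / (1 + Complex.exp (-2 * Complex.I * (a : ℂ)) * z) with hb
  have hbr : b = ((b.re : ℝ) : ℂ) := Complex.ext (by simp) (by simp [hns.2])
  have hdd : 1 + Complex.exp (-2 * Complex.I * (a : ℂ)) * z = Complex.exp (-(a * Complex.I)) * d := by
    rw [hd, mul_add, exp_neg_mul_I_mul_exp_mul_I, exp_neg_two_mul_I_mul]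
    ring
  have h1 : 1 - z = b.re * (Complex.exp (-(a * Complex.I)) * d) := by
    rw [← hbr, ← hdd, hb, div_mul_cancel₀ _ hne]
  have h2 : (1 - z) * (starRingEnd ℂ) d
      = ((b.re * Complex.normSq d : ℝ) : ℂ) * Complex.exp (((-a : ℝ) : ℂ) * Complex.I) := by
    rw [h1, Complex.ofReal_mul, Complex.normSq_eq_conj_mul_self, Complex.ofReal_neg, neg_mul]
    ring
  rw [h2, Complex.re_ofReal_mul, Complex.exp_ofReal_mul_I_re, Real.cos_neg] at hpos
  have h3 : b.re * Complex.normSq d ≤ 0 :=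
    mul_nonpos_of_nonpos_of_nonneg hns.1 (Complex.normSq_nonneg d)
  nlinarith

theorem differentiableOn_h {ν : ℂ} {a : ℝ} (ha : |a| < Real.pi / 2) :
    DifferentiableOn ℂ (h ν a) disk := by
  intro z hz
  have hz' : ‖z‖ < 1 := mem_ball_zero_iff.1 hz
  have h1 : DifferentiableAt ℂ
      (fun z => (1 - z) / (1 + Complex.exp (-2 * Complex.I * (a : ℂ)) * z)) z :=
    DifferentiableAt.div (by fun_prop) (by fun_prop) (one_add_exp_mul_ne_zero hz')
  exact (h1.cpow (differentiableAt_const ν) (h_base_mem_slitPlane ha hz')).differentiableWithinAt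

/-- A function whose logarithm, divided by `ν`, stays in the strip `|Im - a| < π / 2` is
subordinate to `h ν a`. -/
theorem subordinate_h_of_abs_im_sub_lt {f L : ℂ → ℂ} {ν : ℂ} {a : ℝ} (hν : ν ≠ 0)
    (hL : IsLogBranch f L) (hf : DifferentiableOn ℂ f disk) (ha : |a| < Real.pi / 2)
    (him : ∀ z ∈ disk, |(1 / ν * L z).im - a| < Real.pi / 2) :
    Subordinate f (h ν a) := by
  obtain ⟨hLd, hL0, hLf⟩ := hL
  have hcos : 0 < Real.cos a := Real.cos_pos_of_mem_Ioo (abs_lt.1 ha)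
  set e := Complex.exp (a * Complex.I) with he
  set e' := Complex.exp (-(a * Complex.I)) with he'
  set c := Complex.exp (-2 * Complex.I * (a : ℂ)) with hc
  have hee : e' * e = 1 := exp_neg_mul_I_mul_exp_mul_I a
  have hce : c = e' * e' := exp_neg_two_mul_I_mul a
  have hneg : e' = Complex.exp (((-a : ℝ) : ℂ) * Complex.I) := by
    rw [he']
    push_cast
    ring_nf
  have her : e.re = Real.cos a := Complex.exp_ofReal_mul_I_re a
  have hei : e.im = Real.sin a := Complex.exp_ofReal_mul_I_im a
  have her' : e'.re = Real.cos a := by rw [hneg, Complex.exp_ofReal_mul_I_re, Real.cos_neg]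
  have hei' : e'.im = -Real.sin a := by rw [hneg, Complex.exp_ofReal_mul_I_im, Real.sin_neg]
  have hne : ‖e‖ = 1 := Complex.norm_exp_ofReal_mul_I a
  have hne' : ‖e'‖ = 1 := by rw [hneg, Complex.norm_exp_ofReal_mul_I]
  set g : ℂ → ℂ := fun z => Complex.exp (1 / ν * L z) with hg
  have hspos : ∀ z ∈ disk, 0 < (e' * g z).re := by
    intro z hz
    have : e' * g z = Complex.exp (1 / ν * L z - a * Complex.I) := by
      rw [he', hg, ← Complex.exp_add]
      ring_nf
    rw [this, Complex.exp_re]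
    refine mul_pos (Real.exp_pos _) (Real.cos_pos_of_mem_Ioo ?_)
    have h1 := abs_lt.1 (him z hz)
    simpa using h1
  have hden : ∀ z ∈ disk, 1 + c * g z ≠ 0 := by
    intro z hz h0
    have h1 : 1 + c * g z = e' * (e + e' * g z) := by rw [mul_add, hee, hce]; ring
    rw [h1, mul_eq_zero] at h0
    rcases h0 with h0 | h0
    · exact Complex.exp_ne_zero _ h0
    · have h2 := congrArg Complex.re h0
      rw [Complex.add_re, her, Complex.zero_re] at h2
      linarith [hspos z hz]
  have hgd : DifferentiableOn ℂ g disk := (hLd.const_mul _).cexp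
  set ω : ℂ → ℂ := fun z => (1 - g z) / (1 + c * g z) with hω
  -- The map w ↦ (1-w)/(1+cw) is its own inverse, so `ω` solves (1-ω)/(1+cω) = g.
  have hωd : DifferentiableOn ℂ ω disk :=
    ((differentiableOn_const 1).sub hgd).div
      ((differentiableOn_const 1).add (hgd.const_mul c)) hden
  have hω0 : ω 0 = 0 := by simp [hω, hg, hL0]
  have hω1 : Set.MapsTo ω (Metric.ball 0 1) (Metric.closedBall 0 1) := by
    intro z hz
    rw [mem_closedBall_zero_iff, hω, norm_div, div_le_one (norm_pos_iff.2 (hden z hz))]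
    set s := e' * g z with hs
    have h1 : 1 - g z = e * (e' - s) := by
      rw [hs, mul_sub, ← mul_assoc, mul_comm e e', hee, one_mul]
    have h2 : 1 + c * g z = e' * (e + s) := by rw [hs, mul_add, hee, hce]; ring
    rw [h1, h2, norm_mul, norm_mul, hne, hne', one_mul, one_mul]
    -- Since e' is the conjugate of e, |e+s|² - |e'-s|² = 4 cos a · Re s > 0.
    refine abs_le_of_sq_le_sq' ?_ (norm_nonneg _) |>.2
    rw [← Complex.normSq_eq_norm_sq, ← Complex.normSq_eq_norm_sq, Complex.normSq_apply,
      Complex.normSq_apply]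
    simp only [Complex.sub_re, Complex.sub_im, Complex.add_re, Complex.add_im, her, hei, her', hei']
    have := mul_pos hcos (hspos z hz)
    nlinarith
  refine ⟨hf, differentiableOn_h ha, ω, hωd, fun z hz =>
    Complex.norm_le_norm_of_mapsTo_ball hωd hω1 hω0 (mem_ball_zero_iff.1 hz), fun z hz => ?_⟩
  have hc1 : 1 + c ≠ 0 := by
    have h1 : 1 + c = e' * (e + e') := by rw [mul_add, hee, hce]
    rw [h1]
    refine mul_ne_zero (Complex.exp_ne_zero _) fun h0 => ?_
    have h2 := congrArg Complex.re h0
    rw [Complex.add_re, her, her', Complex.zero_re] at h2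
    linarith
  have hd := hden z hz
  have hbase : (1 - ω z) / (1 + c * ω z) = g z := by
    have hωz : ω z = (1 - g z) / (1 + c * g z) := rfl
    have h1 : 1 - ω z = g z * (1 + c) / (1 + c * g z) := by
      rw [hωz, eq_div_iff hd, sub_mul, div_mul_cancel₀ _ hd]
      ring
    have h2 : 1 + c * ω z = (1 + c) / (1 + c * g z) := by
      rw [hωz, eq_div_iff hd, add_mul, mul_assoc, div_mul_cancel₀ _ hd]
      ring
    rw [h1, h2, div_div_div_cancel_right₀ hd, mul_div_assoc, div_self hc1, mul_one]
  -- The strip and |a| < π/2 together keep the imaginary part within the range of the principal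
  -- logarithm.
  have hpi : |(1 / ν * L z).im| < Real.pi := by
    have h1 := abs_lt.1 (him z hz)
    have h2 := abs_lt.1 ha
    rw [abs_lt]
    constructor <;> linarith
  rw [h, ← hc, hbase, Complex.cpow_def_of_ne_zero (Complex.exp_ne_zero _),
    Complex.log_exp (abs_lt.1 hpi).1 (abs_lt.1 hpi).2.le, ← hLf z hz]
  congr 1
  field_simp

end SpiralBoundary

/-! ### Integral representation in the class G(μ, β) -/

namespace SpiralBoundary

/-- The closed disk about 1 of radius 1 is convex and contains 0. -/
theorem Omega.smul_mem {μ : ℂ} (hμ : μ ∈ Omega) {R : ℝ} (hR0 : 0 < R) (hR1 : R ≤ 1) :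
    μ * R ∈ Omega := by
  refine ⟨?_, mul_ne_zero hμ.2 (Complex.ofReal_ne_zero.2 hR0.ne')⟩
  have h1 : μ * R - 1 = (R : ℂ) * (μ - 1) - ((1 - R : ℝ) : ℂ) := by
    push_cast
    ring
  rw [h1]
  refine (norm_sub_le _ _).trans ?_
  rw [norm_mul, Complex.norm_real, Complex.norm_real, Real.norm_of_nonneg hR0.le,
    Real.norm_of_nonneg (by linarith)]
  nlinarith [hμ.1]

/-- **Herglotz representation** in the class `G(μ, β)`. -/
theorem MemG.exists_measure {μ : ℂ} {β : ℝ} {f : ℂ → ℂ} (hβ1 : β < 1) (hf : MemG μ β f) :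
    ∃ σ : Measure (Metric.sphere (0 : ℂ) 1), IsProbabilityMeasure σ ∧
      ∀ z ∈ Metric.ball (0 : ℂ) 1,
        2 / μ * (z * deriv f z / f z) + (1 + z) / (1 - z) = β + (1 - β) *
          ∫ y : Metric.sphere (0 : ℂ) 1, (1 + z * (y : ℂ)) / (1 - z * (y : ℂ)) ∂σ := by
  have hβ : (0 : ℝ) < 1 - β := by linarith
  have hβ' : (1 - β : ℂ) ≠ 0 := by exact_mod_cast hβ.ne'
  have hfd : DifferentiableOn ℂ (deriv f) (Metric.ball 0 1) := hf.holo.deriv Metric.isOpen_ball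
  have hone : ∀ z ∈ Metric.ball (0 : ℂ) 1, 1 - z ≠ 0 := fun z hz h => by
    have := re_one_sub_pos_of_norm_lt_one (mem_ball_zero_iff.1 hz)
    rw [h] at this
    simp at this
  set q : ℂ → ℂ := fun z =>
    ((2 / μ * (z * deriv f z / f z) + (1 + z) / (1 - z)) - β) / ((1 - β : ℝ) : ℂ) with hq
  have hqd : DifferentiableOn ℂ q (Metric.ball 0 1) := by
    refine DifferentiableOn.div_const (DifferentiableOn.sub_const (DifferentiableOn.add
      (DifferentiableOn.const_mul (DifferentiableOn.div (differentiableOn_id.mul hfd) hf.holo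
        hf.ne_zero) _) (DifferentiableOn.div (by fun_prop) (by fun_prop) hone)) _) _
  have hq0 : q 0 = 1 := by
    simp [hq, hβ']
  have hre : ∀ z ∈ Metric.ball (0 : ℂ) 1, 0 < (q z).re := by
    intro z hz
    rw [hq, Complex.div_ofReal_re, Complex.sub_re, Complex.ofReal_re]
    exact div_pos (sub_pos.2 (hf.ineq z hz)) hβ
  obtain ⟨σ, hσ, hrep⟩ := exists_herglotz_measure hqd hq0 hre
  refine ⟨σ, hσ, fun z hz => ?_⟩
  rw [← hrep z hz, hq]
  push_cast
  rw [mul_div_cancel₀ _ hβ']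
  ring

/-- The representation of `f'/f` integrates to a representation of the logarithm of `f`. -/
theorem MemG.isLogBranch {μ : ℂ} (hμ : μ ≠ 0) {β : ℝ} {f : ℂ → ℂ} (hf : MemG μ β f)
    (σ : Measure (Metric.sphere (0 : ℂ) 1)) [IsProbabilityMeasure σ]
    (hσ : ∀ z ∈ Metric.ball (0 : ℂ) 1,
      2 / μ * (z * deriv f z / f z) + (1 + z) / (1 - z) = β + (1 - β) *
        ∫ y : Metric.sphere (0 : ℂ) 1, (1 + z * (y : ℂ)) / (1 - z * (y : ℂ)) ∂σ) :
    IsLogBranch f fun z => μ * (Complex.log (1 - z) - (1 - β) * logPotential σ z) := by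
  set L : ℂ → ℂ := fun z => μ * (Complex.log (1 - z) - (1 - β) * logPotential σ z) with hL
  have hopen : IsOpen (Metric.ball (0 : ℂ) 1) := Metric.isOpen_ball
  have hL' : ∀ z ∈ Metric.ball (0 : ℂ) 1, HasDerivAt L
      (μ * (-1 / (1 - z) - (1 - β) * deriv (logPotential σ) z)) z := by
    intro z hz
    have h1 : HasDerivAt (fun z => Complex.log (1 - z)) (-1 / (1 - z)) z :=
      ((hasDerivAt_id' z).const_sub 1).clog
        (Or.inl (re_one_sub_pos_of_norm_lt_one (mem_ball_zero_iff.1 hz)))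
    have h2 := (hasDerivAt_logPotential σ hz).differentiableAt.hasDerivAt
    exact (h1.sub (h2.const_mul _)).const_mul μ
  have hLd : DifferentiableOn ℂ L (Metric.ball 0 1) := fun z hz =>
    (hL' z hz).differentiableAt.differentiableWithinAt
  have hL0 : L 0 = 0 := by simp [hL, logPotential_zero]
  have hlog : ∀ z ∈ Metric.ball (0 : ℂ) 1, z ≠ 0 → deriv f z - f z * deriv L z = 0 := by
    intro z hz hz0
    have h1 := hσ z hz
    have h2 := mul_deriv_logPotential σ hz
    have h3 : 1 - z ≠ 0 := fun h => by
      have := re_one_sub_pos_of_norm_lt_one (mem_ball_zero_iff.1 hz)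
      rw [h] at this
      simp at this
    have h4 := hf.ne_zero z hz
    rw [(hL' z hz).deriv]
    set Q := ∫ y : Metric.sphere (0 : ℂ) 1, (1 + z * (y : ℂ)) / (1 - z * (y : ℂ)) ∂σ
    have h5 : z * deriv f z / f z
        = z * (μ * (-1 / (1 - z) - (1 - β) * deriv (logPotential σ) z)) := by
      have h6 : z * (μ * (-1 / (1 - z) - (1 - β) * deriv (logPotential σ) z))
          = μ * (-z / (1 - z) - (1 - β) * (z * deriv (logPotential σ) z)) := by ring
      have h7 : z * deriv f z / f z = μ / 2 * (β + (1 - β) * Q - (1 + z) / (1 - z)) := by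
        rw [← h1, add_sub_cancel_right, ← mul_assoc, div_mul_div_cancel₀ two_ne_zero,
          div_self hμ, one_mul]
      rw [h6, h7, h2]
      field_simp
      ring
    rw [mul_div_assoc] at h5
    have h8 := mul_left_cancel₀ hz0 h5
    rw [← h8, mul_div_cancel₀ _ h4, sub_self]
  have hlog0 : ∀ z ∈ Metric.ball (0 : ℂ) 1, deriv f z - f z * deriv L z = 0 := by
    intro z hz
    -- The representation carries a factor z that cannot be cancelled at 0; continuity covers that
    -- point.
    rcases eq_or_ne z 0 with rfl | hz0
    · have hcont : ContinuousAt (fun z => deriv f z - f z * deriv L z) 0 := by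
        have hd : DifferentiableOn ℂ (fun z => deriv f z - f z * deriv L z) (Metric.ball 0 1) :=
          (hf.holo.deriv hopen).sub (hf.holo.mul (hLd.deriv hopen))
        exact (hd.differentiableAt (hopen.mem_nhds hz)).continuousAt
      refine tendsto_nhds_unique (hcont.tendsto.mono_left (nhdsWithin_le_nhds (s := {0}ᶜ))) ?_
      refine tendsto_const_nhds.congr' ?_
      filter_upwards [self_mem_nhdsWithin, nhdsWithin_le_nhds (hopen.mem_nhds hz)] with w hw hw1
      exact (hlog w hw1 hw).symm
    · exact hlog z hz hz0
  refine ⟨hLd, hL0, fun z hz => ?_⟩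
  have hF : ∀ w ∈ Metric.ball (0 : ℂ) 1, HasDerivAt (fun z => f z * Complex.exp (-L z)) 0 w := by
    intro w hw
    have h1 := (hf.holo.differentiableAt (hopen.mem_nhds hw)).hasDerivAt
    have h2 := (hLd.differentiableAt (hopen.mem_nhds hw)).hasDerivAt
    refine (h1.mul h2.neg.cexp).congr_deriv ?_
    linear_combination Complex.exp (-L w) * hlog0 w hw
  have hconst := hopen.is_const_of_deriv_eq_zero (convex_ball (0 : ℂ) 1).isPreconnected
    (fun w hw => (hF w hw).differentiableAt.differentiableWithinAt)
    (fun w hw => (hF w hw).deriv) hz (Metric.mem_ball_self one_pos)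
  rw [hL0, hf.map_zero, neg_zero, Complex.exp_zero, one_mul, Complex.exp_neg] at hconst
  have := mul_inv_eq_one₀ (Complex.exp_ne_zero (L z)) |>.1 hconst
  exact this.symm

end SpiralBoundary

/-! ### The main theorem -/

theorem corollary1p5 (μ : ℂ) (hμ : μ ∈ SpiralBoundary.Omega) (β : ℝ) (hβ0 : 0 ≤ β) (hβ1 : β < 1)
    (f : ℂ → ℂ) (hf : SpiralBoundary.MemG μ β f) :
    ∃ (ν : ℂ) (a : ℝ),
      ν ∈ SpiralBoundary.Omega ∧
      SpiralBoundary.HasBoundaryExponent f ν ∧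
      SpiralBoundary.HasBoundaryArg f ν a ∧
      SpiralBoundary.Subordinate f (SpiralBoundary.h ν a) ∧
      (∃ R : ℝ, ν / μ = (R : ℂ) ∧ β ≤ R ∧ R ≤ 1 ∧ |a| < Real.pi / 2 * (1 / R) * (1 - β)) ∧
      |a| < Real.pi / 2 ∧
      (β ≠ 0 → |a| < Real.pi / 2 * min 1 ((1 - β) / β)) := by
  have hμ0 : μ ≠ 0 := hμ.2
  obtain ⟨σ, hprob, hσ⟩ := hf.exists_measure hβ1
  have hL := hf.isLogBranch hμ0 σ hσ
  set L : ℂ → ℂ := fun z => μ * (Complex.log (1 - z) - (1 - β) * logPotential σ z) with hLdef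
  let o : Metric.sphere (0 : ℂ) 1 := ⟨1, by simp⟩
  set s : ℝ := σ.real {o} with hs
  have hs0 : 0 ≤ s := measureReal_nonneg
  have hs1 : s ≤ 1 := measureReal_le_one
  set R : ℝ := 1 - (1 - β) * s with hR
  have hβR : β ≤ R := by nlinarith
  have hR1 : R ≤ 1 := by nlinarith
  have hball : ∀ z ∈ SpiralBoundary.disk, ‖z‖ < 1 := fun z hz => mem_ball_zero_iff.1 hz
  -- R = 0 would need β = 0 and s = 1; then `σ` is the unit mass at 1, `L` vanishes and f ≡ 1,
  -- against injectivity.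
  have hR0 : 0 < R := by
    rcases hβ0.lt_or_eq with h | h
    · exact h.trans_le hβR
    rcases hs1.lt_or_eq with h1 | h1
    · rw [hR, ← h]
      linarith
    · exfalso
      have hLz : ∀ z, L z = 0 := by
        intro z
        have : logPotential σ z = Complex.log (1 - z) := by
          rw [logPotential, integral_eq_apply_of_measureReal_singleton_eq_one h1]
          simp [o]
        simp [hLdef, this, ← h]
      have hf1 : ∀ z ∈ SpiralBoundary.disk, f z = 1 := by
        intro z hz
        rw [← hL.2.2 z hz, hLz, Complex.exp_zero]
      have h0 : (0 : ℂ) ∈ SpiralBoundary.disk := Metric.mem_ball_self one_pos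
      have h2 : (1 / 2 : ℂ) ∈ SpiralBoundary.disk := by
        rw [SpiralBoundary.disk, mem_ball_zero_iff]
        norm_num
      have := hf.inj h0 h2 (by rw [hf1 _ h0, hf1 _ h2])
      norm_num at this
  have hRne : (R : ℂ) ≠ 0 := Complex.ofReal_ne_zero.2 hR0.ne'
  have hνne : μ * R ≠ 0 := mul_ne_zero hμ0 hRne
  set A : ℝ := ∫ y : Metric.sphere (0 : ℂ) 1, (1 - (y : ℂ)).arg ∂σ with hA
  set a : ℝ := -((1 - β) / R * A) with ha
  have him : ∀ z ∈ SpiralBoundary.disk, (1 / (μ * R) * L z).im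
      = 1 / R * ((1 - z).arg - (1 - β) * (logPotential σ z).im) := by
    intro z hz
    have h1 : 1 / (μ * R) * L z
        = ((1 / R : ℝ) : ℂ) * (Complex.log (1 - z) - ((1 - β : ℝ) : ℂ) * logPotential σ z) := by
      rw [hLdef]
      push_cast
      field_simp
    rw [h1, Complex.im_ofReal_mul, Complex.sub_im, Complex.im_ofReal_mul, Complex.log_im]
  -- `u z` is the contribution of a point of the circle to the argument of `f ^ (1 / ν)`
  let u : ℂ → Metric.sphere (0 : ℂ) 1 → ℝ := fun z y =>
    (1 - z).arg - (1 - z * y).arg + (1 - (y : ℂ)).arg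
  have hu_meas : ∀ z, Measurable (u z) := fun z => by fun_prop
  have hu_lt : ∀ z ∈ SpiralBoundary.disk, ∀ y, |u z y| < Real.pi / 2 := fun z hz y =>
    abs_arg_add_arg_sub_arg_lt (hball z hz) (norm_eq_of_mem_sphere y)
  have hu_one : ∀ z, u z o = 0 := fun z => by simp [u, o]
  have hu_int : ∀ z ∈ SpiralBoundary.disk,
      ∫ y, u z y ∂σ = (1 - z).arg - (logPotential σ z).im + A := by
    intro z hz
    have hi1 : Integrable (fun y : Metric.sphere (0 : ℂ) 1 => (1 - z * (y : ℂ)).arg) σ :=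
      integrable_of_abs_lt (by fun_prop) (abs_arg_one_sub_mul_lt hz)
    have hi2 : Integrable (fun y : Metric.sphere (0 : ℂ) 1 => (1 - (y : ℂ)).arg) σ :=
      integrable_of_abs_lt (c := 2 * Real.pi) (by fun_prop) fun y =>
        (Complex.abs_arg_le_pi _).trans_lt (by linarith [Real.pi_pos])
    rw [im_logPotential σ hz, hA]
    simp only [u]
    rw [integral_add (f := fun y : Metric.sphere (0 : ℂ) 1 => (1 - z).arg - (1 - z * (y : ℂ)).arg)
      ((integrable_const _).sub hi1) hi2, integral_sub (integrable_const _) hi1]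
    simp
  have hstrip : ∀ z ∈ SpiralBoundary.disk, |(1 / (μ * R) * L z).im - a| < Real.pi / 2 := by
    intro z hz
    -- Split arg(1-z) as β arg(1-z) + (1-β) arg(1-z) and absorb the second piece into `u`.
    have h1 : (1 / (μ * R) * L z).im - a
        = (β * (1 - z).arg + (1 - β) * ∫ y, u z y ∂σ) / R := by
      rw [him z hz, hu_int z hz, ha]
      field_simp
      ring
    have h2 : |(1 - z).arg| < Real.pi / 2 :=
      abs_arg_lt_pi_div_two_of_re_pos (re_one_sub_pos_of_norm_lt_one (hball z hz))
    have h3 : |β * (1 - z).arg + (1 - β) * ∫ y, u z y ∂σ|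
        ≤ β * |(1 - z).arg| + (1 - β) * |∫ y, u z y ∂σ| := by
      refine (abs_add_le _ _).trans_eq ?_
      rw [abs_mul, abs_mul, abs_of_nonneg hβ0, abs_of_pos (by linarith : 0 < 1 - β)]
    rw [h1, abs_div, abs_of_pos hR0, div_lt_iff₀ hR0]
    refine h3.trans_lt ?_
    -- If s < 1, strictness comes from the integral, which also covers β = 0. If s = 1, the integral
    -- vanishes and R = β > 0, so it comes from arg(1-z).
    rcases hs1.lt_or_eq with h | h
    · have h4 := abs_integral_lt_mul_one_sub_of_apply_eq_zero (σ := σ) (x := o) (hu_meas z)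
        (hu_lt z hz) (hu_one z) h
      rw [← hs] at h4
      have h5 := mul_lt_mul_of_pos_left h4 (by linarith : 0 < 1 - β)
      have h6 := mul_le_mul_of_nonneg_left h2.le hβ0
      rw [hR]
      linarith
    · have h4 : R = β := by rw [hR, h]; ring
      rw [integral_eq_apply_of_measureReal_singleton_eq_one h, hu_one, abs_zero, mul_zero, add_zero,
        h4, mul_comm]
      exact mul_lt_mul_of_pos_right h2 (h4 ▸ hR0)
  have h0 : (0 : ℂ) ∈ SpiralBoundary.disk := Metric.mem_ball_self one_pos
  have ha2 : |a| < Real.pi / 2 := by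
    have := hstrip 0 h0
    rwa [hL.2.1, mul_zero, Complex.zero_im, zero_sub, abs_neg] at this
  have haR : |a| < Real.pi / 2 * (1 / R) * (1 - β) := by
    -- At z = 0 the function `u` reduces to arg(1-y).
    have h1 : |A| < Real.pi / 2 := by
      have := abs_integral_lt_of_apply_eq_zero (σ := σ) (x := o) (hu_meas 0) (hu_lt 0 h0) (hu_one 0)
      simpa [u, hA] using this
    have h2 : 0 < (1 - β) / R := div_pos (by linarith) hR0
    rw [ha, abs_neg, abs_mul, abs_of_pos h2]
    refine (mul_lt_mul_of_pos_left h1 h2).trans_eq ?_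
    ring
  have hIoo : ∀ᶠ r : ℝ in 𝓝[<] 1, r ∈ Set.Ioo (0 : ℝ) 1 := Ioo_mem_nhdsLT one_pos
  refine ⟨μ * R, a, SpiralBoundary.Omega.smul_mem hμ hR0 hR1, ?_, ⟨L, hL, ?_⟩,
    SpiralBoundary.subordinate_h_of_abs_im_sub_lt hνne hL hf.holo ha2 hstrip,
    ⟨R, by field_simp, hβR, hR1, haR⟩, ha2, fun hβne => ?_⟩
  · have h1 := tendsto_one_sub_mul_integral_herglotzKernel σ
    have hr : Tendsto (fun r : ℝ => (r : ℂ)) (𝓝[<] 1) (𝓝 1) := by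
      have := Complex.continuous_ofReal.tendsto (1 : ℝ)
      rw [Complex.ofReal_one] at this
      exact this.mono_left nhdsWithin_le_nhds
    -- This is f'(r)(r-1)/f(r) solved from the representation; the Herglotz integral times 1-r tends
    -- to 2s.
    have h2 : Tendsto (fun r : ℝ => μ / (2 * (r : ℂ)) * ((1 + (r : ℂ)) - β * (1 - (r : ℂ))
        - (1 - β) * ((1 - (r : ℂ)) * ∫ y : Metric.sphere (0 : ℂ) 1,
          (1 + (r : ℂ) * (y : ℂ)) / (1 - (r : ℂ) * (y : ℂ)) ∂σ))) (𝓝[<] 1)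
        (𝓝 (μ / (2 * 1) * ((1 + 1) - β * (1 - 1) - (1 - β) * (2 * (s : ℂ))))) :=
      (tendsto_const_nhds.div (hr.const_mul 2) (by norm_num)).mul
        (((hr.const_add 1).sub ((hr.const_sub 1).const_mul _)).sub (h1.const_mul _))
    have h3 : μ / (2 * 1) * ((1 + 1) - β * (1 - 1) - (1 - β) * (2 * (s : ℂ))) = μ * (R : ℂ) := by
      rw [hR]
      push_cast
      ring
    rw [h3] at h2
    refine h2.congr' ?_
    filter_upwards [hIoo] with r hr
    have hz := ofReal_mem_ball_of_mem_Ioo hr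
    have h4 := hσ r hz
    have h5 : (r : ℂ) ≠ 0 := Complex.ofReal_ne_zero.2 hr.1.ne'
    have h6 : 1 - (r : ℂ) ≠ 0 := by
      simpa [o] using one_sub_mul_ne_zero_of_mem_ball hz o
    have h7 := hf.ne_zero r hz
    set Q := ∫ y : Metric.sphere (0 : ℂ) 1,
      (1 + (r : ℂ) * (y : ℂ)) / (1 - (r : ℂ) * (y : ℂ)) ∂σ
    have h8 : (1 - β : ℂ) * ((1 - (r : ℂ)) * Q) = (1 - (r : ℂ)) *
        (2 / μ * (r * deriv f r / f r) + (1 + r) / (1 - r) - β) := by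
      rw [h4]
      ring
    rw [h8]
    field_simp
    ring
  · have h1 : Tendsto (fun r : ℝ => 1 / R * (0 - (1 - β) * (logPotential σ (r : ℂ)).im))
        (𝓝[<] 1) (𝓝 (1 / R * (0 - (1 - β) * A))) :=
      (((tendsto_im_logPotential σ).const_mul _).const_sub _).const_mul _
    have h2 : 1 / R * (0 - (1 - β) * A) = a := by rw [ha]; ring
    rw [h2] at h1
    refine h1.congr' ?_
    filter_upwards [hIoo] with r hr
    rw [him r (ofReal_mem_ball_of_mem_Ioo hr), ← Complex.ofReal_one, ← Complex.ofReal_sub,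
      Complex.arg_ofReal_of_nonneg (by linarith [hr.2])]
  · have hβpos : 0 < β := lt_of_le_of_ne hβ0 (Ne.symm hβne)
    rw [mul_min_of_nonneg _ _ (by positivity), mul_one, lt_min_iff]
    refine ⟨ha2, haR.trans_le ?_⟩
    -- What remains is (1-β)/R ≤ (1-β)/β, from β ≤ R.
    rw [mul_assoc, one_div_mul_eq_div]
    have : 0 ≤ 1 - β := by linarith
    gcongr
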